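/- For a finite set $A\subseteq\mathbb{Z}^n$ put $\mathrm{gap}(A)=\sum_{i=1}^n|\pi_i(A)|-|A|$, where $\pi_i:\mathbb{Z}^n\to\mathbb{Z}^{n-1}$ deletes the $i$-th coordinate. A set $A\subseteq\mathbb{Z}^n$ is a weak antichain if it contains no two elements $x,y$ with $x_i<y_i$ for all $i$. Let $X_n$ be the set of all $x\in\mathbb{Z}_{\ge 0}^n$ with at least one coordinate equal to $0$. The balanced order on $X_n$ is the total order defined as follows: for distinct $x,y\in X_n$ let $T=\{i: x_i\neq y_i\}$; then $x<y$ if and only if either $\max_{i\in T}x_i<\max_{i\in T}y_i$, or these two maxima are equal, say to $M$, and $\max\{i\in T: x_i=M\}<\max\{i\in T: y_i=M\}$. Theorem. Let $n\ge 2$. For every $m\ge 0$ there is exactly one initial segment of size $m$ of the balanced order on $X_n$, and it is a weak antichain that minimises the gap among all weak antichains in $\mathbb{Z}^n$ of size $m$. In particular, for every positive integer $N$, the set $$A_N=\{x\in\mathbb{Z}^n: 0\le x_j\le N-1\text{ for all } j\text{ and } x_i=0\text{ for some } i\}$$ has size $N^n-(N-1)^n$ and is a weak antichain that minimises the gap among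 all weak antichains in $\mathbb{Z}^n$ of size $|A_N|$. -/

import Mathlib

/-- The projection `π_i` forgetting the `i`-th coordinate; `ℤⁿ⁻¹` is indexed by the remaining
coordinates. -/
def proj {n : ℕ} (i : Fin n) (x : Fin n → ℤ) : {j : Fin n // j ≠ i} → ℤ :=
  fun j => x j

/-- `gap A = ∑ i, |π_i(A)| - |A|`, an integer. -/
def gap {n : ℕ} (A : Finset (Fin n → ℤ)) : ℤ :=
  (∑ i : Fin n, ((A.image (proj i)).card : ℤ)) - (A.card : ℤ)

/-- The points of `ℤⁿ` with non-negative coordinates, at least one of which is zero. -/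
def X (n : ℕ) : Set (Fin n → ℤ) :=
  {x | (∀ i, 0 ≤ x i) ∧ ∃ i, x i = 0}

/-- The set `T` of coordinates in which `x` and `y` differ. -/
def diffSet {n : ℕ} (x y : Fin n → ℤ) : Finset (Fin n) :=
  Finset.univ.filter fun i => x i ≠ y i

/-- The (strict) balanced order. With `T` the set of coordinates where `x` and `y` differ,
`x < y` if `max_T x < max_T y`, or if these maxima are equal and the last position in `T` at which
`x` attains `max_T x` comes before the last position in `T` at which `y` attains `max_T y`.
For `x = y` the set `T` is empty and the relation does not hold. (The two sets of positions below
are non-empty, so that the comparison of their maxima in `WithBot (Fin n)` is the one in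
`Fin n`.) -/
def BalancedLT {n : ℕ} (x y : Fin n → ℤ) : Prop :=
  ∃ hT : (diffSet x y).Nonempty,
    (diffSet x y).sup' hT x < (diffSet x y).sup' hT y ∨
    ((diffSet x y).sup' hT x = (diffSet x y).sup' hT y ∧
      ((diffSet x y).filter fun i => x i = (diffSet x y).sup' hT x).max <
        ((diffSet x y).filter fun i => y i = (diffSet x y).sup' hT y).max)

/-- `I` is a (finite) initial segment of the balanced order on `X n`. -/
def IsBalancedInitialSegment {n : ℕ} (I : Finset (Fin n → ℤ)) : Prop :=
  (∀ x ∈ I, x ∈ X n) ∧ ∀ x ∈ I, ∀ y ∈ X n, BalancedLT y x → y ∈ I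

/-- `A` is a weak antichain in `ℤⁿ` whose gap is minimal among all weak antichains in `ℤⁿ` of the
same size. (`IsWeakAntichain S` says that no two distinct elements `x`, `y` of `S` satisfy `x i < y i`
for all `i`.) -/
def MinimisesGap {n : ℕ} (A : Finset (Fin n → ℤ)) : Prop :=
  IsWeakAntichain (A : Set (Fin n → ℤ)) ∧
    ∀ B : Finset (Fin n → ℤ), IsWeakAntichain (B : Set (Fin n → ℤ)) → B.card = A.card → gap A ≤ gap B

/-- `A_N`: the points of `[0, N - 1]ⁿ` with at least one zero coordinate. -/
noncomputable def cubeFaces (n N : ℕ) : Finset (Fin n → ℤ) :=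
  (Fintype.piFinset fun _ : Fin n => Finset.Icc (0 : ℤ) ((N : ℤ) - 1)).filter
    fun x => ∃ i, x i = 0

/-! Two reductions prove the theorem. First, `exists_projSum_le` moves any weak antichain into `X n`
with the same size and no larger projections, compressing one coordinate at a time: the lowest point
on each line goes to height `0` and the others are translated to positive heights. Weak antichains
have no pair `x < y`; after all directions this becomes the absence of a point with all coordinates
positive. It remains to minimise the projection sum inside `X n`, which is `IsInitial.projSum_le`.
Its proof is an induction on the set `S` of active coordinates, for the orthant with or without the
condition that some coordinate is zero. Both versions are needed: slicing the boundary at height `0`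
gives a full orthant, and at positive height a boundary again. The balanced order is encoded by an
integer key, and an extremal set is one whose key sum cannot be lowered at the same size without
raising the projection sum. Such a set is a down-set, and by induction its slices are initial
segments (`IsExtremal.isInitial_levelSet`). If it were not itself initial, exchanging its last
point, or a segment ending there, for missing earlier points would lower the key sum
(`IsExtremal.isInitial`). Since there is only one initial segment of each size, it has the least
projection sum. -/

open Finset Function

/-! ### The balanced order as a comparison of integers -/

/-- Binary encoding of the balanced order: `x` precedes `y` iff `balancedKey x < balancedKey y`. -/
def balancedKey {n : ℕ} (x : Fin n → ℕ) : ℕ := ∑ i, 2 ^ (n * x i + i)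

theorem exponent_injective {n a b : ℕ} {i j : Fin n} (h : n * a + i = n * b + j) :
    a = b ∧ i = j := by
  have hi := i.2
  have hj := j.2
  have h1 : (n * a + i) / n = a := by
    rw [Nat.mul_add_div (by omega), Nat.div_eq_of_lt hi, add_zero]
  have h2 : (n * b + j) / n = b := by
    rw [Nat.mul_add_div (by omega), Nat.div_eq_of_lt hj, add_zero]
  have hab : a = b := by rw [← h1, ← h2, h]
  subst hab
  exact ⟨rfl, Fin.ext (by omega)⟩

theorem le_of_exponent_lt {n a b : ℕ} {i j : Fin n} (h : n * a + i < n * b + j) : a ≤ b := by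
  by_contra hab
  have hj := j.2
  have : n * (b + 1) ≤ n * a := Nat.mul_le_mul_left n (by omega)
  rw [mul_add] at this
  omega

theorem exponent_lt_of_lt {n a b : ℕ} (i j : Fin n) (h : a < b) : n * a + i < n * b + j := by
  have hi := i.2
  have : n * (a + 1) ≤ n * b := Nat.mul_le_mul_left n (by omega)
  rw [mul_add] at this
  omega

/-- Common coordinates contribute equally to both keys. The remaining exponents of `x` are distinct
and below one exponent of `y`, and distinct powers of two below `2 ^ e` sum to less than `2 ^ e`. -/
theorem balancedKey_lt_of_witness {n : ℕ} {x y : Fin n → ℕ} (k : Fin n) (hk : x k ≠ y k)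
    (h : ∀ i, x i ≠ y i → n * x i + i < n * y k + k) : balancedKey x < balancedKey y := by
  classical
  unfold balancedKey
  rw [← sum_filter_add_sum_filter_not univ (fun i => x i ≠ y i),
    ← sum_filter_add_sum_filter_not univ (fun i => x i ≠ y i) (fun i => 2 ^ (n * y i + (i : ℕ)))]
  have h1 : ∑ i ∈ univ.filter (fun i => ¬ x i ≠ y i), 2 ^ (n * x i + (i : ℕ)) =
      ∑ i ∈ univ.filter (fun i => ¬ x i ≠ y i), 2 ^ (n * y i + (i : ℕ)) :=
    sum_congr rfl fun i hi => by
      rw [mem_filter, not_not] at hi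
      rw [hi.2]
  rw [h1]
  apply Nat.add_lt_add_right
  have h2 : ∑ i ∈ univ.filter (fun i => x i ≠ y i), 2 ^ (n * x i + (i : ℕ)) =
      ∑ e ∈ (univ.filter (fun i => x i ≠ y i)).image (fun i => n * x i + (i : ℕ)), 2 ^ e := by
    rw [sum_image]
    intro i _ j _ hij
    exact (exponent_injective hij).2
  rw [h2]
  refine (Nat.geomSum_lt le_rfl (n := n * y k + k) ?_).trans_le ?_
  · intro e he
    obtain ⟨i, hi, rfl⟩ := mem_image.1 he
    exact h i (mem_filter.1 hi).2
  · exact single_le_sum (f := fun i : Fin n => 2 ^ (n * y i + (i : ℕ))) (fun _ _ => Nat.zero_le _)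
      (mem_filter.2 ⟨mem_univ k, hk⟩)

theorem exists_witness {n : ℕ} {x y : Fin n → ℕ} (hxy : x ≠ y) :
    (∃ k, x k ≠ y k ∧ ∀ i, x i ≠ y i → n * x i + i < n * y k + k) ∨
      ∃ k, y k ≠ x k ∧ ∀ i, y i ≠ x i → n * y i + i < n * x k + k := by
  classical
  have hT : (univ.filter (fun i => x i ≠ y i)).Nonempty := by
    obtain ⟨i, hi⟩ := Function.ne_iff.1 hxy
    exact ⟨i, mem_filter.2 ⟨mem_univ i, hi⟩⟩
  obtain ⟨k, hk, hmax⟩ := exists_max_image _ (fun i => n * max (x i) (y i) + (i : ℕ)) hT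
  have hk' := (mem_filter.1 hk).2
  rcases lt_or_gt_of_ne hk' with h | h
  · refine Or.inl ⟨k, hk', fun i hi => ?_⟩
    have h1 := hmax i (mem_filter.2 ⟨mem_univ i, hi⟩)
    simp only [max_eq_right h.le] at h1
    have h2 : n * x i ≤ n * max (x i) (y i) := Nat.mul_le_mul_left n (le_max_left _ _)
    refine lt_of_le_of_ne (by omega) fun he => ?_
    obtain ⟨h3, rfl⟩ := exponent_injective he
    omega
  · refine Or.inr ⟨k, hk'.symm, fun i hi => ?_⟩
    have h1 := hmax i (mem_filter.2 ⟨mem_univ i, hi.symm⟩)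
    simp only [max_eq_left h.le] at h1
    have h2 : n * y i ≤ n * max (x i) (y i) := Nat.mul_le_mul_left n (le_max_right _ _)
    refine lt_of_le_of_ne (by omega) fun he => ?_
    obtain ⟨h3, rfl⟩ := exponent_injective he
    omega

theorem balancedKey_lt_iff {n : ℕ} {x y : Fin n → ℕ} : balancedKey x < balancedKey y ↔
    ∃ k, x k ≠ y k ∧ ∀ i, x i ≠ y i → n * x i + i < n * y k + k := by
  refine ⟨fun h => ?_, fun ⟨k, hk, h⟩ => balancedKey_lt_of_witness k hk h⟩
  rcases exists_witness (x := x) (y := y) (by rintro rfl; exact lt_irrefl _ h) with h' | ⟨k, hk, h'⟩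
  · exact h'
  · exact absurd (balancedKey_lt_of_witness k hk h') h.asymm

theorem balancedKey_injective {n : ℕ} : Injective (balancedKey (n := n)) := by
  intro x y h
  by_contra hxy
  rcases exists_witness hxy with ⟨k, hk, h'⟩ | ⟨k, hk, h'⟩
  · exact (balancedKey_lt_of_witness k hk h').ne h
  · exact (balancedKey_lt_of_witness k hk h').ne h.symm

theorem balancedKey_update {n : ℕ} (x : Fin n → ℕ) (i : Fin n) (t : ℕ) :
    balancedKey (update x i t) + 2 ^ (n * x i + i) = balancedKey x + 2 ^ (n * t + i) := by
  classical
  unfold balancedKey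
  rw [← add_sum_erase univ _ (mem_univ i), ← add_sum_erase univ (fun j => 2 ^ (n * x j + (j : ℕ)))
    (mem_univ i)]
  have : ∑ j ∈ univ.erase i, 2 ^ (n * update x i t j + (j : ℕ)) =
      ∑ j ∈ univ.erase i, 2 ^ (n * x j + (j : ℕ)) :=
    sum_congr rfl fun j hj => by rw [update_of_ne (ne_of_mem_erase hj)]
  rw [this, update_self]
  ring

theorem balancedKey_update_lt {n : ℕ} {x : Fin n → ℕ} {i : Fin n} {t : ℕ} (h : t < x i) :
    balancedKey (update x i t) < balancedKey x := by
  refine balancedKey_lt_of_witness i (by simpa using h.ne) fun j hj => ?_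
  have : j = i := by
    by_contra hji
    exact hj (update_of_ne hji _ _)
  subst this
  rw [update_self]
  exact exponent_lt_of_lt _ _ h

/-- Both keys change by the same amount, so a slice inherits the order of the whole space. -/
theorem balancedKey_update_lt_update {n : ℕ} {x y : Fin n → ℕ} {i : Fin n} (hi : x i = y i) (t : ℕ) :
    balancedKey (update x i t) < balancedKey (update y i t) ↔ balancedKey x < balancedKey y := by
  have h1 := balancedKey_update x i t
  have h2 := balancedKey_update y i t
  rw [hi] at h1
  omega

/-! ### Initial segments and key sums -/

/-- `I` is an initial segment of `D` for the balanced order. -/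
def IsInitial {n : ℕ} (D : Set (Fin n → ℕ)) (I : Finset (Fin n → ℕ)) : Prop :=
  (∀ x ∈ I, x ∈ D) ∧ ∀ x ∈ I, ∀ y ∈ D, balancedKey y < balancedKey x → y ∈ I

namespace IsInitial

variable {n : ℕ} {D : Set (Fin n → ℕ)} {I J : Finset (Fin n → ℕ)}

theorem subset_or_subset (hI : IsInitial D I) (hJ : IsInitial D J) : I ⊆ J ∨ J ⊆ I := by
  by_contra! h
  obtain ⟨x, hxI, hxJ⟩ := not_subset.1 h.1
  obtain ⟨y, hyJ, hyI⟩ := not_subset.1 h.2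
  rcases lt_trichotomy (balancedKey x) (balancedKey y) with h | h | h
  · exact hxJ (hJ.2 y hyJ x (hI.1 x hxI) h)
  · rw [balancedKey_injective h] at hxI
    exact hyI hxI
  · exact hyI (hI.2 x hxI y (hJ.1 y hyJ) h)

theorem subset_of_card_le (hI : IsInitial D I) (hJ : IsInitial D J) (h : I.card ≤ J.card) :
    I ⊆ J := by
  rcases hI.subset_or_subset hJ with h' | h'
  · exact h'
  · exact (eq_of_subset_of_card_le h' h).symm.subset

theorem eq_of_card_eq (hI : IsInitial D I) (hJ : IsInitial D J) (h : I.card = J.card) : I = J :=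
  eq_of_subset_of_card_le (hI.subset_of_card_le hJ h.le) h.ge

theorem mono {D' : Set (Fin n → ℕ)} (hI : IsInitial D I) (hD : D' ⊆ D) [DecidablePred (· ∈ D')] :
    IsInitial D' (I.filter (· ∈ D')) := by
  refine ⟨fun x hx => (mem_filter.1 hx).2, fun x hx y hy hyx => ?_⟩
  exact mem_filter.2 ⟨hI.2 x (mem_filter.1 hx).1 y (hD hy) hyx, hy⟩

end IsInitial

theorem isInitial_of_sum_key_le {n : ℕ} {D : Set (Fin n → ℕ)} {A : Finset (Fin n → ℕ)}
    (hA : ∀ x ∈ A, x ∈ D)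
    (hmin : ∀ B : Finset (Fin n → ℕ), (∀ x ∈ B, x ∈ D) → B.card = A.card →
      ∑ x ∈ A, balancedKey x ≤ ∑ x ∈ B, balancedKey x) : IsInitial D A := by
  refine ⟨hA, fun x hx y hy hyx => ?_⟩
  by_contra hyA
  have hy' : y ∉ A.erase x := fun h => hyA (mem_of_mem_erase h)
  have h1 := hmin (insert y (A.erase x)) (fun w hw => by
    rcases mem_insert.1 hw with rfl | hw
    · exact hy
    · exact hA w (mem_of_mem_erase hw)) (by
      rw [card_insert_of_notMem hy', card_erase_add_one hx])
  rw [sum_insert hy', ← add_sum_erase A _ hx] at h1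
  omega

/-- Every finite subset of `D` has an initial segment of its size; it has the least key sum. -/
theorem exists_isInitial {n : ℕ} {D : Set (Fin n → ℕ)} {A : Finset (Fin n → ℕ)}
    (hA : ∀ x ∈ A, x ∈ D) : ∃ I, IsInitial D I ∧ I.card = A.card ∧
      ∑ x ∈ I, balancedKey x ≤ ∑ x ∈ A, balancedKey x ∧
      (∑ x ∈ A, balancedKey x ≤ ∑ x ∈ I, balancedKey x → A = I) := by
  classical
  let P : Set (Finset (Fin n → ℕ)) := {B | (∀ x ∈ B, x ∈ D) ∧ B.card = A.card}
  have hP : P.Nonempty := ⟨A, hA, rfl⟩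
  obtain ⟨I, hI, hmin⟩ := exists_minimalFor_of_wellFoundedLT (· ∈ P)
    (fun B => ∑ x ∈ B, balancedKey x) hP
  have hle : ∀ B ∈ P, ∑ x ∈ I, balancedKey x ≤ ∑ x ∈ B, balancedKey x := fun B hB => by
    by_contra h
    exact h (hmin hB (not_le.1 h).le)
  have hI' : IsInitial D I := isInitial_of_sum_key_le hI.1 fun B hB hc =>
    hle B ⟨hB, hc.trans hI.2⟩
  refine ⟨I, hI', hI.2, hle A ⟨hA, rfl⟩, fun h => ?_⟩
  refine IsInitial.eq_of_card_eq (isInitial_of_sum_key_le hA fun B hB hc => ?_) hI' hI.2.symm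
  exact h.trans (hle B ⟨hB, hc⟩)

/-! ### Orthants, projections and slices -/

/-- The points of the orthant supported on `S`, with a zero coordinate in `S` if `b` holds. -/
def orthant {n : ℕ} (b : Prop) (S : Finset (Fin n)) : Set (Fin n → ℕ) :=
  {x | (∀ i ∉ S, x i = 0) ∧ (b → ∃ i ∈ S, x i = 0)}

/-- The sum of the sizes of the projections of `A` in the directions of `S`. -/
def projSum {n : ℕ} (S : Finset (Fin n)) (A : Finset (Fin n → ℕ)) : ℕ :=
  ∑ j ∈ S, (A.image fun x => update x j 0).card

theorem projSum_mono {n : ℕ} (S : Finset (Fin n)) {A B : Finset (Fin n → ℕ)} (h : A ⊆ B) :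
    projSum S A ≤ projSum S B :=
  sum_le_sum fun _ _ => card_le_card (image_subset_image h)

theorem update_mem_orthant {n : ℕ} {b : Prop} {S : Finset (Fin n)} {x : Fin n → ℕ}
    (hx : x ∈ orthant b S) {i : Fin n} {t : ℕ} (hi : t ≤ x i) : update x i t ∈ orthant b S := by
  refine ⟨fun j hj => ?_, fun hb => ?_⟩
  · have h := hx.1 j hj
    by_cases hji : j = i
    · subst hji
      rw [update_self]
      omega
    · rwa [update_of_ne hji]
  · obtain ⟨j, hj, h⟩ := hx.2 hb
    refine ⟨j, hj, ?_⟩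
    by_cases hji : j = i
    · subst hji
      rw [update_self]
      omega
    · rwa [update_of_ne hji]

theorem IsInitial.update_mem {n : ℕ} {b : Prop} {S : Finset (Fin n)} {I : Finset (Fin n → ℕ)}
    (hI : IsInitial (orthant b S) I) {x : Fin n → ℕ} (hx : x ∈ I) {i : Fin n} {t : ℕ}
    (hi : t ≤ x i) : update x i t ∈ I := by
  rcases hi.eq_or_lt with rfl | hi
  · rwa [update_eq_self]
  · exact hI.2 x hx _ (update_mem_orthant (hI.1 x hx) hi.le) (balancedKey_update_lt hi)

/-- The points of `A` with `i`-th coordinate `t`, moved to the hyperplane where it is `0`. -/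
def levelSet {n : ℕ} (A : Finset (Fin n → ℕ)) (i : Fin n) (t : ℕ) : Finset (Fin n → ℕ) :=
  (A.filter (· i = t)).image fun x => update x i 0

/-- The set whose slices in direction `i` are the first `R` sets of `J`. -/
def stack {n : ℕ} (i : Fin n) (R : ℕ) (J : ℕ → Finset (Fin n → ℕ)) : Finset (Fin n → ℕ) :=
  (range R).biUnion fun t => (J t).image fun x => update x i t

section slices

variable {n : ℕ} {i : Fin n} {R : ℕ} {J : ℕ → Finset (Fin n → ℕ)} {A : Finset (Fin n → ℕ)}

theorem mem_levelSet {t : ℕ} {w : Fin n → ℕ} :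
    w ∈ levelSet A i t ↔ w i = 0 ∧ update w i t ∈ A := by
  unfold levelSet
  simp only [mem_image, mem_filter]
  constructor
  · rintro ⟨x, ⟨hx, rfl⟩, rfl⟩
    simp [hx]
  · rintro ⟨h0, h⟩
    refine ⟨_, ⟨h, update_self ..⟩, ?_⟩
    rw [update_idem, ← h0, update_eq_self]

theorem mem_stack {w : Fin n → ℕ} (hJ : ∀ t, ∀ x ∈ J t, x i = 0) :
    w ∈ stack i R J ↔ w i < R ∧ update w i 0 ∈ J (w i) := by
  unfold stack
  simp only [mem_biUnion, mem_range, mem_image]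
  constructor
  · rintro ⟨t, ht, x, hx, rfl⟩
    have : update x i 0 = x := by rw [← hJ t x hx, update_eq_self]
    simp [ht, this, hx]
  · rintro ⟨h1, h2⟩
    exact ⟨_, h1, _, h2, by simp⟩

theorem stack_levelSet (hR : ∀ x ∈ A, x i < R) : stack i R (levelSet A i) = A := by
  ext w
  rw [mem_stack fun t x hx => (mem_levelSet.1 hx).1, mem_levelSet]
  simp only [update_self, update_idem, update_eq_self, true_and]
  exact ⟨fun h => h.2, fun h => ⟨hR w h, h⟩⟩

theorem stack_pairwiseDisjoint :
    Set.PairwiseDisjoint (range R : Set ℕ) fun t => (J t).image fun x => update x i t := by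
  intro s _ t _ hst
  rw [Function.onFun, disjoint_left]
  intro w hs ht
  obtain ⟨x, _, rfl⟩ := mem_image.1 hs
  obtain ⟨y, _, h⟩ := mem_image.1 ht
  have := congr_fun h i
  simp at this
  exact hst this.symm

theorem update_injOn {t : ℕ} {B : Finset (Fin n → ℕ)} (hB : ∀ x ∈ B, x i = 0) :
    Set.InjOn (fun x : Fin n → ℕ => update x i t) B := by
  intro x hx y hy h
  have h' := congr_arg (fun w => update w i 0) h
  simp only [update_idem] at h'
  have hx0 := hB x hx
  have hy0 := hB y hy
  rwa [← hx0, update_eq_self, hx0, ← hy0, update_eq_self] at h'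

theorem card_stack (hJ : ∀ t, ∀ x ∈ J t, x i = 0) :
    (stack i R J).card = ∑ t ∈ range R, (J t).card := by
  unfold stack
  rw [card_biUnion stack_pairwiseDisjoint]
  exact sum_congr rfl fun t _ => card_image_of_injOn (update_injOn (hJ t))

/-- Beyond the key sums of the slices, the key sum of a stack depends only on their sizes. Hence
replacing slices by others of equal sizes changes the total exactly as it changes the slices. -/
theorem sum_key_stack (hJ : ∀ t, ∀ x ∈ J t, x i = 0) :
    ∑ x ∈ stack i R J, balancedKey x + ∑ t ∈ range R, (J t).card * 2 ^ (i : ℕ) =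
      ∑ t ∈ range R, ∑ x ∈ J t, balancedKey x +
        ∑ t ∈ range R, (J t).card * 2 ^ (n * t + i) := by
  unfold stack
  rw [sum_biUnion stack_pairwiseDisjoint, ← sum_add_distrib, ← sum_add_distrib]
  refine sum_congr rfl fun t _ => ?_
  rw [sum_image (update_injOn (hJ t)), ← smul_eq_mul, ← smul_eq_mul, ← sum_const, ← sum_const,
    ← sum_add_distrib, ← sum_add_distrib]
  refine sum_congr rfl fun x hx => ?_
  have := balancedKey_update x i t
  rwa [hJ t x hx, mul_zero, zero_add] at this

theorem image_update_stack {j : Fin n} (hj : j ≠ i) :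
    (stack i R J).image (fun x => update x j 0) =
      stack i R fun t => (J t).image fun x => update x j 0 := by
  unfold stack
  rw [biUnion_image]
  refine biUnion_congr rfl fun t _ => ?_
  rw [image_image, image_image]
  refine image_congr fun x _ => ?_
  exact update_comm hj.symm _ _ _

theorem image_update_self_stack (hJ : ∀ t, ∀ x ∈ J t, x i = 0) :
    (stack i R J).image (fun x => update x i 0) = (range R).biUnion J := by
  unfold stack
  rw [biUnion_image]
  refine biUnion_congr rfl fun t _ => ?_
  rw [image_image]
  conv_rhs => rw [← image_id (s := J t)]
  refine image_congr fun x hx => ?_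
  simp only [comp_apply, update_idem, id]
  rw [← hJ t x hx, update_eq_self]

/-- The projection along `i` is the union of the slices; every other projection is computed slice by
slice. -/
theorem projSum_stack (hJ : ∀ t, ∀ x ∈ J t, x i = 0) {S : Finset (Fin n)} (hi : i ∈ S) :
    projSum S (stack i R J) =
      ((range R).biUnion J).card + ∑ t ∈ range R, projSum (S.erase i) (J t) := by
  unfold projSum
  rw [← add_sum_erase S _ hi, image_update_self_stack hJ, sum_comm]
  congr 1
  refine sum_congr rfl fun j hj => ?_
  have hji := ne_of_mem_erase hj
  rw [image_update_stack hji, card_stack]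
  intro t x hx
  obtain ⟨y, hy, rfl⟩ := mem_image.1 hx
  rw [update_of_ne hji.symm]
  exact hJ t y hy

/-- At height `0` coordinate `i` already supplies the required zero, so the condition survives only
for `t ≠ 0`. -/
theorem levelSet_mem_orthant {b : Prop} {S : Finset (Fin n)} (hA : ∀ x ∈ A, x ∈ orthant b S)
    {t : ℕ} {w : Fin n → ℕ} (hw : w ∈ levelSet A i t) : w ∈ orthant (b ∧ t ≠ 0) (S.erase i) := by
  obtain ⟨h0, hw⟩ := mem_levelSet.1 hw
  have := hA _ hw
  refine ⟨fun j hj => ?_, fun hb => ?_⟩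
  · by_cases hji : j = i
    · rwa [hji]
    · have := this.1 j fun h => hj (mem_erase.2 ⟨hji, h⟩)
      rwa [update_of_ne hji] at this
  · obtain ⟨j, hj, h⟩ := this.2 hb.1
    have hji : j ≠ i := by
      rintro rfl
      exact hb.2 (by simpa using h)
    rw [update_of_ne hji] at h
    exact ⟨j, mem_erase.2 ⟨hji, hj⟩, h⟩

theorem update_mem_orthant_of_erase {b : Prop} {S : Finset (Fin n)} (hi : i ∈ S)
    {t : ℕ} {w : Fin n → ℕ} (hw : w ∈ orthant (b ∧ t ≠ 0) (S.erase i)) :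
    update w i t ∈ orthant b S := by
  refine ⟨fun j hj => ?_, fun hb => ?_⟩
  · have hji : j ≠ i := by
      rintro rfl
      exact hj hi
    rw [update_of_ne hji]
    exact hw.1 j fun h => hj (mem_of_mem_erase h)
  · by_cases ht : t = 0
    · exact ⟨i, hi, by simp [ht]⟩
    · obtain ⟨j, hj, h⟩ := hw.2 ⟨hb, ht⟩
      refine ⟨j, mem_of_mem_erase hj, ?_⟩
      rwa [update_of_ne (ne_of_mem_erase hj)]

end slices

/-! ### Extremal sets are down-sets -/

/-- `A` has the least projection sum among the subsets of `D` of its size, and the least key sum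
among those. -/
structure IsExtremal {n : ℕ} (S : Finset (Fin n)) (D : Set (Fin n → ℕ))
    (A : Finset (Fin n → ℕ)) : Prop where
  subset : ∀ x ∈ A, x ∈ D
  sum_le : ∀ B : Finset (Fin n → ℕ), (∀ x ∈ B, x ∈ D) → B.card = A.card →
    projSum S B ≤ projSum S A → ∑ x ∈ A, balancedKey x ≤ ∑ x ∈ B, balancedKey x

theorem exists_isExtremal {n : ℕ} (S : Finset (Fin n)) {D : Set (Fin n → ℕ)}
    {A : Finset (Fin n → ℕ)} (hA : ∀ x ∈ A, x ∈ D) :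
    ∃ B, IsExtremal S D B ∧ B.card = A.card ∧ projSum S B ≤ projSum S A := by
  classical
  let P : Set (Finset (Fin n → ℕ)) :=
    {B | (∀ x ∈ B, x ∈ D) ∧ B.card = A.card ∧ projSum S B ≤ projSum S A}
  have hP : P.Nonempty := ⟨A, hA, rfl, le_rfl⟩
  obtain ⟨I, hI, hmin⟩ := exists_minimalFor_of_wellFoundedLT (· ∈ P)
    (fun B => ∑ x ∈ B, balancedKey x) hP
  refine ⟨I, ⟨hI.1, fun B hB hc hp => ?_⟩, hI.2⟩
  by_contra h
  exact h (hmin ⟨hB, hc.trans hI.2.1, hp.trans hI.2.2⟩ (not_le.1 h).le)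

/-- Shift the points with `i`-th coordinate `t + 1` down by one where possible. -/
def shiftPoint {n : ℕ} (A : Finset (Fin n → ℕ)) (i : Fin n) (t : ℕ) (x : Fin n → ℕ) :
    Fin n → ℕ :=
  if x i = t + 1 ∧ update x i t ∉ A then update x i t else x

theorem shiftPoint_injOn {n : ℕ} (A : Finset (Fin n → ℕ)) (i : Fin n) (t : ℕ) :
    Set.InjOn (shiftPoint A i t) A := by
  intro x hx y hy h
  unfold shiftPoint at h
  split_ifs at h with h1 h2 h2
  · have := congr_arg (fun w => update w i (t + 1)) h
    simp only [update_idem] at this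
    rwa [← h1.1, update_eq_self, h1.1, ← h2.1, update_eq_self] at this
  · exact absurd (h ▸ hy) h1.2
  · exact absurd (h ▸ hx) h2.2
  · exact h

/-- For `j ≠ i`, the projection of the shifted set lies in the shift of the projection `Q`, which
has at most `Q.card` points. -/
theorem image_update_shiftPoint_subset {n : ℕ} (A : Finset (Fin n → ℕ)) (i : Fin n) (t : ℕ)
    (j : Fin n) : ((A.image (shiftPoint A i t)).image fun x => update x j 0).card ≤
      (A.image fun x => update x j 0).card := by
  by_cases hji : j = i
  · subst hji
    refine card_le_card fun w hw => ?_
    simp only [mem_image, exists_exists_and_eq_and] at hw ⊢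
    obtain ⟨x, hx, rfl⟩ := hw
    refine ⟨x, hx, ?_⟩
    unfold shiftPoint
    split_ifs <;> simp
  · set Q := A.image fun x => update x j 0 with hQ
    refine le_trans (card_le_card ?_) (card_image_le (s := Q) (f := shiftPoint Q i t))
    intro w hw
    simp only [mem_image, exists_exists_and_eq_and] at hw
    obtain ⟨x, hx, rfl⟩ := hw
    have hxQ : update x j 0 ∈ Q := mem_image_of_mem _ hx
    by_cases h : x i = t + 1
    · by_cases h2 : update (update x j 0) i t ∈ Q
      · by_cases h3 : update x i t ∈ A
        · refine mem_image.2 ⟨_, hxQ, ?_⟩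
          simp [shiftPoint, h2, h3]
        · refine mem_image.2 ⟨_, h2, ?_⟩
          simp [shiftPoint, h, h3, update_comm hji]
      · have h3 : update x i t ∉ A := fun h3 => h2 (by
          rw [update_comm hji]
          exact mem_image_of_mem _ h3)
        refine mem_image.2 ⟨_, hxQ, ?_⟩
        rw [update_comm hji] at h2
        simp [shiftPoint, h, h2, h3, update_of_ne (Ne.symm hji), update_comm hji]
    · refine mem_image.2 ⟨_, hxQ, ?_⟩
      simp [shiftPoint, h, update_of_ne (Ne.symm hji)]

theorem IsExtremal.pred_mem {n : ℕ} {b : Prop} {S : Finset (Fin n)} {A : Finset (Fin n → ℕ)}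
    (hA : IsExtremal S (orthant b S) A) {x : Fin n → ℕ} (hx : x ∈ A) {i : Fin n} {t : ℕ}
    (hi : x i = t + 1) : update x i t ∈ A := by
  by_contra hxA
  have hle : ∀ w, balancedKey (shiftPoint A i t w) ≤ balancedKey w := fun w => by
    unfold shiftPoint
    split_ifs with h
    · exact (balancedKey_update_lt (by omega)).le
    · exact le_rfl
  have h := hA.sum_le (A.image (shiftPoint A i t)) (fun w hw => by
    obtain ⟨y, hy, rfl⟩ := mem_image.1 hw
    unfold shiftPoint
    split_ifs with h
    · exact update_mem_orthant (hA.subset y hy) (by omega)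
    · exact hA.subset y hy) (card_image_of_injOn (shiftPoint_injOn A i t))
    (sum_le_sum fun j _ => image_update_shiftPoint_subset A i t j)
  rw [sum_image (shiftPoint_injOn A i t)] at h
  refine h.not_gt (sum_lt_sum (fun w _ => hle w) ⟨x, hx, ?_⟩)
  rw [shiftPoint, if_pos ⟨hi, hxA⟩]
  exact balancedKey_update_lt (by omega)

theorem IsExtremal.update_mem {n : ℕ} {b : Prop} {S : Finset (Fin n)} {A : Finset (Fin n → ℕ)}
    (hA : IsExtremal S (orthant b S) A) {x : Fin n → ℕ} (hx : x ∈ A) {i : Fin n} {t : ℕ}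
    (hi : t ≤ x i) : update x i t ∈ A := by
  obtain ⟨d, hd⟩ := Nat.exists_eq_add_of_le hi
  induction d generalizing t with
  | zero =>
    rw [add_zero] at hd
    rwa [← hd, update_eq_self]
  | succ d ih =>
    have h := ih (t := t + 1) (by omega) (by omega)
    have := hA.pred_mem h (i := i) (t := t) (by simp)
    rwa [update_idem] at this

theorem IsExtremal.mem_of_le {n : ℕ} {b : Prop} {S : Finset (Fin n)} {A : Finset (Fin n → ℕ)}
    (hA : IsExtremal S (orthant b S) A) {x y : Fin n → ℕ} (hx : x ∈ A) (hyx : ∀ i, y i ≤ x i) :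
    y ∈ A := by
  have : ∀ T : Finset (Fin n), T.piecewise y x ∈ A := fun T => by
    induction T using Finset.induction_on with
    | empty => simpa using hx
    | insert i T hi ih =>
      rw [piecewise_insert]
      refine hA.update_mem ih ?_
      rw [piecewise_eq_of_notMem _ _ _ hi]
      exact hyx i
  simpa using this univ

/-! ### Slices of extremal sets are initial segments -/

/-- Comparability of initial segments puts the part of `I` in `orthant d T` inside `K`, so every
projection of `I` lies in that of `K`. A point of `K \ I` has a zero coordinate, so it is its own
projection in that direction, and it is not a projection of `I`, as those belong to `I`. This pays
for `J 1 ⊄ J 0` when slices are replaced. -/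
theorem projSum_add_card_sdiff_le {n : ℕ} {c d : Prop} {T : Finset (Fin n)}
    {I K : Finset (Fin n → ℕ)} (hI : IsInitial (orthant c T) I) (hK : IsInitial (orthant d T) K)
    (hc : ¬ c) (hd : d) (hKI : ¬ K ⊆ I) : projSum T I + (K \ I).card ≤ projSum T K := by
  classical
  have hsub : orthant d T ⊆ orthant c T := fun x hx => ⟨hx.1, fun h => absurd h hc⟩
  have hIK : I.filter (· ∈ orthant d T) ⊆ K :=
    ((hI.mono hsub).subset_or_subset hK).resolve_right fun h => hKI (h.trans (filter_subset _ _))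
  have h1 : (K \ I).card ≤ ∑ j ∈ T, ((K \ I).filter (· j = 0)).card := by
    refine le_trans (card_le_card fun x hx => ?_) card_biUnion_le
    obtain ⟨j, hj, h0⟩ := (hK.1 x (mem_sdiff.1 hx).1).2 hd
    exact mem_biUnion.2 ⟨j, hj, mem_filter.2 ⟨hx, h0⟩⟩
  refine (Nat.add_le_add_left h1 _).trans ?_
  unfold projSum
  rw [← sum_add_distrib]
  refine sum_le_sum fun j hj => ?_
  have hII : ∀ x ∈ I, update x j 0 ∈ I := fun x hx => hI.update_mem hx (Nat.zero_le _)
  rw [← card_union_of_disjoint]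
  · refine card_le_card (union_subset (fun w hw => ?_) fun x hx => ?_)
    · obtain ⟨x, hx, rfl⟩ := mem_image.1 hw
      refine mem_image.2 ⟨update x j 0, hIK (mem_filter.2 ⟨hII x hx, ?_⟩), by simp⟩
      exact ⟨(update_mem_orthant (hI.1 x hx) (Nat.zero_le _)).1, fun _ => ⟨j, hj, by simp⟩⟩
    · obtain ⟨hx, h0⟩ := mem_filter.1 hx
      refine mem_image.2 ⟨x, (mem_sdiff.1 hx).1, ?_⟩
      rw [← h0, update_eq_self]
  · rw [disjoint_left]
    intro w hw hw'
    obtain ⟨x, hx, rfl⟩ := mem_image.1 hw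
    exact (mem_sdiff.1 (mem_filter.1 hw').1).2 (hII x hx)

/-- If initial segments minimise the projection sum in one dimension less, then the slices of an
extremal set are initial segments. -/
theorem IsExtremal.isInitial_levelSet {n : ℕ} {b : Prop} {S : Finset (Fin n)}
    {A : Finset (Fin n → ℕ)} (hA : IsExtremal S (orthant b S) A) {i : Fin n} (hi : i ∈ S)
    (ih : ∀ (c : Prop) (I B : Finset (Fin n → ℕ)), IsInitial (orthant c (S.erase i)) I →
      (∀ x ∈ B, x ∈ orthant c (S.erase i)) → I.card = B.card →
      projSum (S.erase i) I ≤ projSum (S.erase i) B) (t : ℕ) :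
    IsInitial (orthant (b ∧ t ≠ 0) (S.erase i)) (levelSet A i t) := by
  have hL : ∀ t, ∀ w ∈ levelSet A i t, w ∈ orthant (b ∧ t ≠ 0) (S.erase i) :=
    fun t w hw => levelSet_mem_orthant hA.subset hw
  choose J hJ hcard hkey heq using fun t => exists_isInitial (hL t)
  obtain ⟨R, htR, hR2, hR⟩ : ∃ R, t < R ∧ 2 ≤ R ∧ ∀ x ∈ A, x i < R :=
    ⟨A.sup (· i) + t + 2, by omega, by omega, fun x hx => by
      have := le_sup (f := fun x : Fin n → ℕ => x i) hx
      omega⟩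
  have hJ0 : ∀ t, ∀ x ∈ J t, x i = 0 := fun t x hx => ((hJ t).1 x hx).1 i (by simp)
  have hL0 : ∀ t, ∀ x ∈ levelSet A i t, x i = 0 := fun t x hx => (mem_levelSet.1 hx).1
  have hle : ∀ t, projSum (S.erase i) (J t) ≤ projSum (S.erase i) (levelSet A i t) :=
    fun t => ih _ _ _ (hJ t) (hL t) (hcard t)
  have hanti : ∀ s t, s ≤ t → levelSet A i t ⊆ levelSet A i s := fun s t hst w hw => by
    rw [mem_levelSet] at hw ⊢
    refine ⟨hw.1, ?_⟩
    have := hA.update_mem hw.2 (i := i) (t := s) (by simpa using hst)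
    rwa [update_idem] at this
  have hUL : ((range R).biUnion (levelSet A i)).card = (J 0).card := by
    rw [hcard]
    congr 1
    refine subset_antisymm (biUnion_subset.2 fun t _ => hanti 0 t (Nat.zero_le t)) ?_
    exact subset_biUnion_of_mem (levelSet A i) (mem_range.2 (by omega))
  -- The sets `J t` with `t ≥ 1` are initial in the same orthant and their sizes decrease, so they
  -- are nested; only `J 0` may fit badly.
  have hUJ : (range R).biUnion J ⊆ J 0 ∪ J 1 := by
    refine biUnion_subset.2 fun t _ => ?_
    rcases Nat.eq_zero_or_pos t with rfl | ht
    · exact subset_union_left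
    · refine Subset.trans ?_ subset_union_right
      have h := hJ t
      rw [show (b ∧ t ≠ 0) = (b ∧ 1 ≠ 0) by simp [ht.ne']] at h
      refine h.subset_of_card_le (hJ 1) ?_
      rw [hcard, hcard]
      exact card_le_card (hanti 1 t ht)
  have hproj : projSum S (stack i R J) ≤ projSum S A := by
    conv_rhs => rw [← stack_levelSet hR]
    rw [projSum_stack hJ0 hi, projSum_stack hL0 hi, hUL]
    by_cases h10 : J 1 ⊆ J 0
    · refine add_le_add (card_le_card (hUJ.trans (union_subset (Subset.refl _) h10))) ?_
      exact sum_le_sum fun t _ => hle t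
    -- The union now exceeds `J 0` by at most `J 1 \ J 0`. This is offset because `projSum` of `J 0`
    -- plus that excess is at most `projSum` of `J 1`, hence of slice `1`, hence of slice `0`.
    · have hb : b := by
        by_contra hb
        have h := hJ 1
        rw [show (b ∧ 1 ≠ 0) = (b ∧ 0 ≠ 0) by simp [hb]] at h
        refine h10 (h.subset_of_card_le (hJ 0) ?_)
        rw [hcard, hcard]
        exact card_le_card (hanti 0 1 zero_le_one)
      have h0 := projSum_add_card_sdiff_le (hJ 0) (hJ 1) (by simp) ⟨hb, one_ne_zero⟩ h10
      have h1 := (hle 1).trans (projSum_mono (S.erase i) (hanti 0 1 zero_le_one))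
      have h2 : ((range R).biUnion J).card ≤ (J 0).card + (J 1 \ J 0).card := by
        refine (card_le_card hUJ).trans ?_
        rw [← union_sdiff_self_eq_union]
        exact card_union_le _ _
      have h3 : ∑ t ∈ (range R).erase 0, projSum (S.erase i) (J t) ≤
          ∑ t ∈ (range R).erase 0, projSum (S.erase i) (levelSet A i t) :=
        sum_le_sum fun t _ => hle t
      have h0R : 0 ∈ range R := mem_range.2 (by omega)
      rw [← add_sum_erase _ _ h0R,
        ← add_sum_erase _ (fun t => projSum (S.erase i) (levelSet A i t)) h0R]
      omega
  have hsum := hA.sum_le (stack i R J) (fun w hw => by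
      obtain ⟨_, hw⟩ := (mem_stack hJ0).1 hw
      have := update_mem_orthant_of_erase hi ((hJ _).1 _ hw)
      rwa [update_idem, update_eq_self] at this) (by
    conv_rhs => rw [← stack_levelSet hR]
    rw [card_stack hJ0, card_stack hL0]
    exact sum_congr rfl fun t _ => hcard t) hproj
  have e1 := sum_key_stack (R := R) hJ0
  have e2 := sum_key_stack (R := R) hL0
  rw [stack_levelSet hR] at e2
  simp only [hcard] at e1
  -- Extremality forces equality of key sums in every slice, and equality characterises the initial
  -- segment.
  have hge : ∑ t ∈ range R, ∑ x ∈ levelSet A i t, balancedKey x ≤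
      ∑ t ∈ range R, ∑ x ∈ J t, balancedKey x := by omega
  have := (sum_eq_sum_iff_of_le fun t _ => hkey t).1
    (le_antisymm (sum_le_sum fun t _ => hkey t) hge) t (mem_range.2 htR)
  rw [heq t this.ge]
  exact hJ t

/-! ### Exchange argument: extremal sets are initial segments -/

theorem IsExtremal.mem_of_key_lt {n : ℕ} {b : Prop} {S : Finset (Fin n)} {A : Finset (Fin n → ℕ)}
    {i : Fin n}
    (hlev : ∀ t, IsInitial (orthant (b ∧ t ≠ 0) (S.erase i)) (levelSet A i t))
    {x y : Fin n → ℕ} (hx : x ∈ orthant b S) (hy : y ∈ A) (hxy : x i = y i)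
    (hlt : balancedKey x < balancedKey y) : x ∈ A := by
  have h1 : update y i 0 ∈ levelSet A i (y i) := mem_levelSet.2 (by simp [hy])
  have h2 : update x i 0 ∈ orthant (b ∧ y i ≠ 0) (S.erase i) :=
    levelSet_mem_orthant (A := {x}) (by simpa using hx) (mem_levelSet.2 (by simp [← hxy]))
  have h3 := (hlev (y i)).2 _ h1 _ h2 ((balancedKey_update_lt_update hxy 0).2 hlt)
  have h4 := (mem_levelSet.1 h3).2
  rwa [update_idem, ← hxy, update_eq_self] at h4

/-- The number of zero coordinates of `x` in `S`. -/
def zeros {n : ℕ} (S : Finset (Fin n)) (x : Fin n → ℕ) : ℕ := (S.filter (x · = 0)).card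

theorem sum_zeros {n : ℕ} (S : Finset (Fin n)) (A : Finset (Fin n → ℕ)) :
    ∑ x ∈ A, zeros S x = ∑ j ∈ S, (A.filter (· j = 0)).card := by
  simp only [zeros, card_filter]
  exact sum_comm

theorem sum_zeros_le_projSum {n : ℕ} (S : Finset (Fin n)) (A : Finset (Fin n → ℕ)) :
    ∑ x ∈ A, zeros S x ≤ projSum S A := by
  rw [sum_zeros]
  refine sum_le_sum fun j _ => card_le_card fun x hx => ?_
  obtain ⟨hx, h0⟩ := mem_filter.1 hx
  exact mem_image.2 ⟨x, hx, by rw [← h0, update_eq_self]⟩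

/-- In a set closed under zeroing coordinates, the projection along `j` is the set of points with
`j`-th coordinate zero. -/
theorem projSum_le_sum_zeros {n : ℕ} {S : Finset (Fin n)} {A : Finset (Fin n → ℕ)}
    (hA : ∀ j ∈ S, ∀ x ∈ A, update x j 0 ∈ A) : projSum S A ≤ ∑ x ∈ A, zeros S x := by
  rw [sum_zeros]
  refine sum_le_sum fun j hj => card_le_card fun w hw => ?_
  obtain ⟨x, hx, rfl⟩ := mem_image.1 hw
  exact mem_filter.2 ⟨hA j hj x hx, by simp⟩

/-- Replacing `L ⊆ A` by `K` of smaller key sum must increase the number of zeros. -/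
theorem IsExtremal.not_exchange {n : ℕ} {D : Set (Fin n → ℕ)} {S : Finset (Fin n)}
    {A K L : Finset (Fin n → ℕ)} (hA : IsExtremal S D A) (hL : L ⊆ A) (hK : Disjoint A K)
    (hKD : ∀ x ∈ K, x ∈ D) (hcard : K.card = L.card)
    (hclosed : ∀ j ∈ S, ∀ x ∈ A \ L ∪ K, update x j 0 ∈ A \ L ∪ K)
    (hzeros : ∑ x ∈ K, zeros S x ≤ ∑ x ∈ L, zeros S x)
    (hkey : ∑ x ∈ K, balancedKey x < ∑ x ∈ L, balancedKey x) : False := by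
  have hdisj : Disjoint (A \ L) K := hK.mono_left sdiff_subset
  have h := hA.sum_le (A \ L ∪ K) (fun x hx => by
    rcases mem_union.1 hx with hx | hx
    · exact hA.subset x (mem_sdiff.1 hx).1
    · exact hKD x hx) (by
      rw [card_union_of_disjoint hdisj, hcard, card_sdiff_add_card_eq_card hL])
    ((projSum_le_sum_zeros hclosed).trans (le_trans ?_ (sum_zeros_le_projSum S A)))
  · rw [sum_union hdisj, ← sum_sdiff hL] at h
    omega
  · rw [sum_union hdisj, ← sum_sdiff hL]
    omega

/-- Let `y` be the last point of `A`, `x` the first missing point, and suppose `x` precedes `y`.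
Since slices are initial, `x` and `y` differ throughout `S`; in fact `x k < y k` at the decisive
position `k` and `y i < x i` at all others. Either `y` can be exchanged for `x`, or, if that creates
zeros, a segment through `y` for one through `x`. -/
theorem IsExtremal.isInitial {n : ℕ} {b : Prop} {S : Finset (Fin n)} {A : Finset (Fin n → ℕ)}
    (hA : IsExtremal S (orthant b S) A)
    (hlev : ∀ i ∈ S, ∀ t, IsInitial (orthant (b ∧ t ≠ 0) (S.erase i)) (levelSet A i t)) :
    IsInitial (orthant b S) A := by
  classical
  by_contra hinit
  obtain ⟨y₀, hy₀, x₀, hx₀, hlt₀, hx₀A⟩ : ∃ y ∈ A, ∃ x ∈ orthant b S,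
      balancedKey x < balancedKey y ∧ x ∉ A := by
    by_contra! h
    exact hinit ⟨hA.subset, h⟩
  obtain ⟨y, hy, hymax⟩ := exists_max_image A balancedKey ⟨y₀, hy₀⟩
  obtain ⟨x, hx, hxmin⟩ := exists_minimalFor_of_wellFoundedLT (· ∈ orthant b S \ (A : Set _))
    balancedKey ⟨x₀, hx₀, by simpa using hx₀A⟩
  have hxA : x ∉ A := by simpa using hx.2
  have hlow : ∀ w ∈ orthant b S, balancedKey w < balancedKey x → w ∈ A := fun w hw hwx => by
    by_contra hwA
    exact absurd (hxmin ⟨hw, by simpa using hwA⟩ hwx.le) (not_le.2 hwx)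
  have hxy : balancedKey x < balancedKey y := by
    refine lt_of_le_of_lt ?_ (hlt₀.trans_le (hymax y₀ hy₀))
    by_contra h
    exact h (hxmin ⟨hx₀, by simpa using hx₀A⟩ (not_le.1 h).le)
  have hcomp : ∀ i ∈ S, ∀ w ∈ A, x i = w i → ¬ balancedKey x < balancedKey w :=
    fun i hi w hw hxw h => hxA (IsExtremal.mem_of_key_lt (hlev i hi) hx.1 hw hxw h)
  have hne : ∀ i ∈ S, x i ≠ y i := fun i hi h => hcomp i hi y hy h hxy
  obtain ⟨k, hk, hexp⟩ := balancedKey_lt_iff.1 hxy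
  have hyD := hA.subset y hy
  have hkS : k ∈ S := by
    by_contra h
    exact hk ((hx.1.1 k h).trans (hyD.1 k h).symm)
  have hexp' : ∀ i ∈ S, n * x i + i < n * y k + k := fun i hi => hexp i (hne i hi)
  have hxk : x k < y k := lt_of_le_of_ne (le_of_exponent_lt (hexp' k hkS)) hk
  -- points of `A` that have the coordinate `y k` in position `k` come after `x`
  have hspike : ∀ w ∈ A, w k = y k → ∀ i ∈ S, x i ≠ w i := fun w hw hwk i hi h => by
    refine hcomp i hi w hw h (balancedKey_lt_of_witness k (by rw [hwk]; exact hk) fun j hj => ?_)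
    rw [hwk]
    refine hexp' j ?_
    by_contra hjS
    exact hj ((hx.1.1 j hjS).trans ((hA.subset w hw).1 j hjS).symm)
  -- Otherwise lowering `y i` to `x i` gives a point of `A` that keeps the decisive coordinate and
  -- agrees with `x` at `i`.
  have hyx : ∀ i ∈ S, i ≠ k → y i < x i := fun i hi hik => by
    by_contra h
    refine hspike (update y i (x i)) (hA.update_mem hy (not_lt.1 h)) ?_ i hi (by simp)
    rw [update_of_ne hik.symm]
  have hup : ∀ w ∈ A, ∀ i ∈ S, y = update w i 0 → w = y := fun w hw i hi h => by
    by_contra hwy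
    have : balancedKey y < balancedKey w := by
      rw [h]
      refine balancedKey_update_lt (Nat.pos_of_ne_zero fun h0 => hwy ?_)
      rw [h, ← h0, update_eq_self]
    exact absurd (hymax w hw) (not_le.2 this)
  by_cases hz : zeros S x ≤ zeros S y
  · refine hA.not_exchange (K := {x}) (L := {y}) (by simpa using hy) (by simpa using hxA)
      (by simpa using hx.1) rfl ?_ (by simpa using hz) (by simpa using hxy)
    intro j hj w hw
    simp only [mem_union, mem_sdiff, mem_singleton] at hw ⊢
    rcases hw with ⟨hw, hwy⟩ | rfl
    · exact Or.inl ⟨hA.update_mem hw (Nat.zero_le _), fun h => hwy (hup w hw j hj h.symm)⟩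
    · by_cases h0 : w j = 0
      · rw [← h0, update_eq_self]
        exact Or.inr rfl
      · have hlt := balancedKey_update_lt (x := w) (Nat.pos_of_ne_zero h0)
        refine Or.inl ⟨hlow _ (update_mem_orthant hx.1 (Nat.zero_le _)) hlt, fun h => ?_⟩
        rw [h] at hlt
        exact lt_asymm hlt hxy
  -- Off `k` the coordinates of `x` exceed those of `y`, so `x` has at most the zero at `k`; having
  -- more zeros than `y`, it has exactly this one and `y` has none.
  · have hxk0 : x k = 0 ∧ ∀ i ∈ S, y i ≠ 0 := by
      have h1 : S.filter (x · = 0) ⊆ {k} := fun i hi => by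
        obtain ⟨hi, h0⟩ := mem_filter.1 hi
        by_contra hik
        have := hyx i hi (by simpa using hik)
        omega
      have h2 := card_le_card h1
      rw [card_singleton] at h2
      unfold zeros at hz
      have h3 : (S.filter (y · = 0)).card = 0 := by omega
      have h4 : (S.filter (x · = 0)).Nonempty := card_pos.1 (by omega)
      refine ⟨?_, fun i hi h => ?_⟩
      · obtain ⟨i, hi⟩ := h4
        have := mem_singleton.1 (h1 hi)
        subst this
        exact (mem_filter.1 hi).2
      · exact notMem_empty i (card_eq_zero.1 h3 ▸ mem_filter.2 ⟨hi, h⟩)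
    obtain ⟨hxk0, hy0⟩ := hxk0
    have hb : ¬ b := fun hb => by
      obtain ⟨j, hj, h⟩ := hyD.2 hb
      exact hy0 j hj h
    have hSk : (S.erase k).Nonempty := by
      by_contra h
      refine hxA (hA.mem_of_le hy fun i => ?_)
      by_cases hik : i = k
      · rw [hik]
        exact hxk.le
      · rw [hx.1.1 i fun hi => h ⟨i, mem_erase.2 ⟨hik, hi⟩⟩]
        exact Nat.zero_le _
    obtain ⟨l, hl, hlmin⟩ := exists_min_image _ y hSk
    obtain ⟨hlk, hlS⟩ := mem_erase.1 hl
    have hlx := hyx l hlS hlk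
    have hxl : x l ≤ y k := le_of_exponent_lt (hexp' l hlS)
    have hinj : ∀ (w : Fin n → ℕ) (i : Fin n), Injective fun c => update w i c :=
      fun w i c d h => by simpa using congr_fun h i
    have hzero : ∀ (w : Fin n → ℕ) (i : Fin n), i ∈ S → (∀ j ∈ S, j ≠ i → w j ≠ 0) → ∀ c,
        zeros S (update w i c) = if c = 0 then 1 else 0 := fun w i hi hw c => by
      unfold zeros
      split_ifs with hc
      · rw [card_eq_one]
        refine ⟨i, ?_⟩
        ext j
        by_cases hji : j = i
        · subst hji
          simp [hi, hc]
        · simpa [hji] using hw j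
      · rw [card_eq_zero, filter_eq_empty_iff]
        intro j hj
        by_cases hji : j = i
        · subst hji
          simpa using hc
        · simpa [hji] using hw j hj hji
    -- Each segment has exactly one zero, at `c = 0`. Minimality of `y l` gives `c ≤ y l ≤ y j < x
    -- j` for `j ≠ k` in `S`, so zeroing such a `j` in a new point gives a predecessor of `x`. Also
    -- `c ≤ y l < x l ≤ y k` makes the new points precede the old ones.
    refine hA.not_exchange (K := (range (y l + 1)).image fun c => update x k c)
      (L := (range (y l + 1)).image fun c => update y l c) ?_ ?_ ?_ ?_ ?_ ?_ ?_
    · intro w hw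
      obtain ⟨c, hc, rfl⟩ := mem_image.1 hw
      exact hA.update_mem hy (Nat.lt_succ_iff.1 (mem_range.1 hc))
    · rw [disjoint_right]
      intro w hw hwA
      obtain ⟨c, hc, rfl⟩ := mem_image.1 hw
      have := hA.update_mem hwA (i := k) (t := 0) (Nat.zero_le _)
      rw [update_idem, ← hxk0, update_eq_self] at this
      exact hxA this
    · intro w hw
      obtain ⟨c, hc, rfl⟩ := mem_image.1 hw
      refine ⟨fun j hj => ?_, fun h => absurd h hb⟩
      rw [update_of_ne (by rintro rfl; exact hj hkS)]
      exact hx.1.1 j hj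
    · rw [card_image_of_injective _ (hinj _ _), card_image_of_injective _ (hinj _ _)]
    · intro j hj w hw
      simp only [mem_union, mem_sdiff, mem_image, mem_range, not_exists, not_and] at hw ⊢
      rcases hw with ⟨hw, hwL⟩ | ⟨c, hc, rfl⟩
      -- A remaining point that projects into the removed segment would extend it beyond `y`,
      -- against the choice of `y` as last.
      · refine Or.inl ⟨hA.update_mem hw (Nat.zero_le _), fun c hc h => ?_⟩
        have hjl : j = l := by
          by_contra hjl
          have := congr_fun h j
          rw [update_self, update_of_ne hjl] at this
          exact hy0 j hj this
        subst hjl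
        have hw' : w = update y j (w j) := by
          have := congr_arg (fun v => update v j (w j)) h
          simpa using this.symm
        have hyw : y j < w j := by
          by_contra hyw
          exact hwL (w j) (by omega) hw'.symm
        have h1 : y = update w j (y j) := by
          have := congr_arg (fun v => update v j (y j)) hw'
          simpa using this.symm
        have h2 := balancedKey_update_lt hyw
        rw [← h1] at h2
        exact absurd (hymax w hw) (not_le.2 h2)
      · by_cases hjk : j = k
        · subst hjk
          exact Or.inr ⟨0, by omega, by simp⟩
        · have hyj := hlmin j (mem_erase.2 ⟨hjk, hj⟩)
          have hxj := hyx j hj hjk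
          rw [update_comm (Ne.symm hjk)]
          refine Or.inl ⟨hlow _ ⟨fun i hi => ?_, fun h => absurd h hb⟩ ?_, fun d _ h => ?_⟩
          · rw [update_of_ne (by rintro rfl; exact hi hkS),
              update_of_ne (by rintro rfl; exact hi hj)]
            exact hx.1.1 i hi
          · refine balancedKey_lt_of_witness j ?_ fun i hi => ?_
            · rw [update_of_ne hjk, update_self]
              omega
            · by_cases hik : i = k
              · subst hik
                rw [update_self]
                exact exponent_lt_of_lt _ _ (by omega)
              · rw [update_of_ne hik] at hi ⊢
                by_cases hij : i = j
                · subst hij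
                  rw [update_self]
                  exact exponent_lt_of_lt _ _ (by omega)
                · exact absurd (update_of_ne hij _ _) hi
          · have := congr_fun h k
            rw [update_self, update_of_ne hlk.symm] at this
            omega
    · rw [sum_image fun c _ d _ h => hinj _ _ h, sum_image fun c _ d _ h => hinj _ _ h]
      refine (sum_congr rfl fun c _ => ?_).le
      rw [hzero x k hkS (fun j hj hjk => by have := hyx j hj hjk; omega),
        hzero y l hlS fun j hj _ => hy0 j hj]
    · rw [sum_image fun c _ d _ h => hinj _ _ h, sum_image fun c _ d _ h => hinj _ _ h]
      refine sum_lt_sum_of_nonempty (by simp) fun c hc => ?_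
      have hc := mem_range.1 hc
      change balancedKey (update x k c) < balancedKey (update y l c)
      refine balancedKey_lt_of_witness k ?_ fun i hi => ?_
      · rw [update_self, update_of_ne hlk.symm]
        omega
      · rw [update_of_ne hlk.symm]
        by_cases hik : i = k
        · subst hik
          rw [update_self]
          exact exponent_lt_of_lt _ _ (by omega)
        · rw [update_of_ne hik] at hi ⊢
          refine hexp' i ?_
          by_contra hiS
          refine hi ?_
          rw [update_of_ne (by rintro rfl; exact hiS hlS), hx.1.1 i hiS, hyD.1 i hiS]

/-- Initial segments of the balanced order minimise the projection sum. -/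
theorem IsInitial.projSum_le {n : ℕ} (S : Finset (Fin n)) :
    ∀ (b : Prop) (I A : Finset (Fin n → ℕ)), IsInitial (orthant b S) I →
      (∀ x ∈ A, x ∈ orthant b S) → I.card = A.card → projSum S I ≤ projSum S A := by
  induction S using Finset.strongInduction with
  | H S ih =>
    intro b I A hI hA hcard
    obtain ⟨B, hB, hBcard, hBA⟩ := exists_isExtremal S hA
    have := hB.isInitial fun i hi => hB.isInitial_levelSet hi (ih _ (erase_ssubset hi))
    rwa [hI.eq_of_card_eq this (hcard.trans hBcard.symm)]

/-! ### Compressing weak antichains into the boundary of the orthant -/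

/-- Move `x` to the hyperplane `x i = 0` if it is the lowest point of `A` on its line in direction
`i`, and translate it by `K` otherwise. -/
noncomputable def liftPoint {n : ℕ} (A : Finset (Fin n → ℤ)) (i : Fin n) (K : ℤ) (x : Fin n → ℤ) : Fin n → ℤ :=
  open Classical in if ∃ s < x i, update x i s ∈ A then update x i (x i + K) else update x i 0

theorem liftPoint_injOn {n : ℕ} {A : Finset (Fin n → ℤ)} {i : Fin n} {K : ℤ}
    (hK : ∀ x ∈ A, 0 < x i + K) : Set.InjOn (liftPoint A i K) A := by
  intro x hx y hy h
  unfold liftPoint at h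
  have hupd : ∀ {a b}, update x i a = update y i b → y = update x i (y i) := fun h => by
    have := congr_arg (fun w => update w i (y i)) h
    simpa using this.symm
  split_ifs at h with h1 h2 h2
  · have hi := congr_fun h i
    simp only [update_self, add_left_inj] at hi
    rw [hupd h, ← hi, update_eq_self]
  · have hi := congr_fun h i
    simp only [update_self] at hi
    exact absurd hi (hK x hx).ne'
  · have hi := congr_fun h i
    simp only [update_self] at hi
    exact absurd hi (hK y hy).ne
  · rcases lt_trichotomy (x i) (y i) with hxy | hxy | hxy
    · refine absurd ⟨x i, hxy, ?_⟩ h2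
      rw [hupd h, update_idem, update_eq_self]
      exact hx
    · rw [hupd h, ← hxy, update_eq_self]
    · refine absurd ⟨y i, hxy, ?_⟩ h1
      rwa [← hupd h]

theorem card_image_update_liftPoint_le {n : ℕ} (A : Finset (Fin n → ℤ)) (i : Fin n) (K : ℤ)
    (j : Fin n) : ((A.image (liftPoint A i K)).image fun x => update x j 0).card ≤
      (A.image fun x => update x j 0).card := by
  by_cases hji : j = i
  · subst hji
    refine card_le_card fun w hw => ?_
    simp only [mem_image, exists_exists_and_eq_and] at hw ⊢
    obtain ⟨x, hx, rfl⟩ := hw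
    refine ⟨x, hx, ?_⟩
    unfold liftPoint
    split_ifs <;> simp
  · set Q := A.image fun x => update x j 0 with hQ
    refine le_trans (card_le_card ?_) (card_image_le (s := Q) (f := liftPoint Q i K))
    intro w hw
    simp only [mem_image, exists_exists_and_eq_and] at hw
    obtain ⟨x, hx, rfl⟩ := hw
    have hxQ : update x j 0 ∈ Q := mem_image_of_mem _ hx
    by_cases h : ∃ s < x i, update x i s ∈ A
    · refine mem_image.2 ⟨_, hxQ, ?_⟩
      obtain ⟨s, hs, hsA⟩ := h
      have h' : ∃ s < update x j 0 i, update (update x j 0) i s ∈ Q := by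
        refine ⟨s, by rwa [update_of_ne (Ne.symm hji)], ?_⟩
        rw [update_comm hji]
        exact mem_image_of_mem _ hsA
      rw [liftPoint, if_pos h', liftPoint, if_pos ⟨s, hs, hsA⟩, update_comm hji,
        update_of_ne (Ne.symm hji)]
    -- The projection of a lowest point of `A` need not be lowest in `Q`; the lowest point of `Q` on
    -- its line has the required image.
    · obtain ⟨m, hm, hmin⟩ := exists_min_image
        (Q.filter fun q => update q i 0 = update (update x j 0) i 0) (fun q => q i)
        ⟨_, mem_filter.2 ⟨hxQ, rfl⟩⟩
      obtain ⟨hmQ, hmx⟩ := mem_filter.1 hm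
      refine mem_image.2 ⟨m, hmQ, ?_⟩
      have h' : ¬ ∃ s < m i, update m i s ∈ Q := fun ⟨s, hs, hsQ⟩ => by
        have := hmin _ (mem_filter.2 ⟨hsQ, by rw [update_idem, hmx]⟩)
        rw [update_self] at this
        omega
      rw [liftPoint, if_neg h', hmx, liftPoint, if_neg h, update_comm hji]

/-- One step of the compression of a weak antichain: the points that are not lowest in direction
`i` get a positive `i`-th coordinate, the others get `0`. -/
theorem exists_lift {n : ℕ} (A : Finset (Fin n → ℤ)) (i : Fin n) :
    ∃ (B : Finset (Fin n → ℤ)) (K : ℤ), B.card = A.card ∧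
      (∀ j, (B.image fun x => update x j 0).card ≤ (A.image fun x => update x j 0).card) ∧
      ∀ w ∈ B, 0 ≤ w i ∧ (∃ s, update w i s ∈ A) ∧
        (0 < w i → update w i (w i - K) ∈ A ∧ ∃ s < w i - K, update w i s ∈ A) := by
  obtain ⟨K, hK⟩ : ∃ K : ℤ, ∀ x ∈ A, 0 < x i + K := by
    refine ⟨∑ x ∈ A, (|x i| + 1), fun x hx => ?_⟩
    have := single_le_sum (f := fun x : Fin n → ℤ => |x i| + 1) (fun y _ => by positivity) hx
    have := neg_abs_le (x i)
    omega
  refine ⟨A.image (liftPoint A i K), K, card_image_of_injOn (liftPoint_injOn hK),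
    card_image_update_liftPoint_le A i K, fun w hw => ?_⟩
  obtain ⟨x, hx, rfl⟩ := mem_image.1 hw
  have hx' : update x i (x i) ∈ A := by rwa [update_eq_self]
  unfold liftPoint
  split_ifs with h
  · simp only [update_self, update_idem, add_sub_cancel_right]
    exact ⟨(hK x hx).le, ⟨_, hx'⟩, fun _ => ⟨hx', h⟩⟩
  · simp only [update_self, update_idem]
    exact ⟨le_rfl, ⟨_, hx'⟩, fun h0 => absurd h0 (lt_irrefl _)⟩

/-! ### Passage between the lattice and the orthant -/

theorem card_image_proj {n : ℕ} (A : Finset (Fin n → ℤ)) (i : Fin n) :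
    (A.image (proj i)).card = (A.image fun x => update x i 0).card := by
  have h : A.image (proj i) = (A.image fun x => update x i 0).image (proj i) := by
    rw [image_image]
    refine image_congr fun x _ => funext fun j => ?_
    simp [proj, update_of_ne j.2]
  rw [h, card_image_of_injOn]
  intro x hx y hy hxy
  obtain ⟨x, _, rfl⟩ := mem_image.1 hx
  obtain ⟨y, _, rfl⟩ := mem_image.1 hy
  funext j
  by_cases hji : j = i
  · subst hji
    simp
  · exact congr_fun hxy ⟨j, hji⟩

/-- The embedding of the orthant in the lattice. -/
def castPoint {n : ℕ} (x : Fin n → ℕ) : Fin n → ℤ := fun i => x i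

theorem castPoint_injective {n : ℕ} : Injective (castPoint (n := n)) := fun x y h =>
  funext fun i => by simpa [castPoint] using congr_fun h i

theorem castPoint_lt {n : ℕ} {x y : Fin n → ℕ} {i j : Fin n} :
    castPoint x i < castPoint y j ↔ x i < y j := Nat.cast_lt

theorem castPoint_le {n : ℕ} {x y : Fin n → ℕ} {i j : Fin n} :
    castPoint x i ≤ castPoint y j ↔ x i ≤ y j := Nat.cast_le

theorem castPoint_eq {n : ℕ} {x y : Fin n → ℕ} {i j : Fin n} :
    castPoint x i = castPoint y j ↔ x i = y j := Nat.cast_inj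

theorem castPoint_update {n : ℕ} (x : Fin n → ℕ) (i : Fin n) :
    castPoint (update x i 0) = update (castPoint x) i 0 := by
  funext j
  by_cases hji : j = i
  · subst hji
    simp [castPoint]
  · simp [castPoint, hji]

theorem card_image_castPoint {n : ℕ} (B : Finset (Fin n → ℕ)) :
    (B.image castPoint).card = B.card := card_image_of_injective _ castPoint_injective

theorem card_image_update_castPoint {n : ℕ} (B : Finset (Fin n → ℕ)) (i : Fin n) :
    ((B.image castPoint).image fun x => update x i 0).card =
      (B.image fun x => update x i 0).card := by
  rw [← card_image_castPoint (B.image fun x => update x i 0), image_image, image_image]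
  congr 1
  exact image_congr fun x _ => (castPoint_update x i).symm

theorem gap_image_castPoint {n : ℕ} (B : Finset (Fin n → ℕ)) :
    gap (B.image castPoint) = (projSum univ B : ℤ) - B.card := by
  unfold gap projSum
  rw [card_image_castPoint, Nat.cast_sum]
  congr 1
  exact sum_congr rfl fun i _ => by rw [card_image_proj, card_image_update_castPoint]

theorem exists_image_castPoint {n : ℕ} {A : Finset (Fin n → ℤ)} (hA : ∀ x ∈ A, ∀ i, 0 ≤ x i) :
    ∃ B : Finset (Fin n → ℕ), A = B.image castPoint := by
  refine ⟨A.image fun x i => (x i).toNat, ?_⟩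
  rw [image_image]
  conv_lhs => rw [← image_id (s := A)]
  refine image_congr fun x hx => funext fun i => ?_
  simp [castPoint, hA x hx i]

theorem castPoint_mem_X {n : ℕ} {x : Fin n → ℕ} :
    castPoint x ∈ X n ↔ x ∈ orthant True (univ : Finset (Fin n)) := by
  simp [X, orthant, castPoint]

/-- A weak antichain can be moved into the boundary of the orthant without increasing the
projections. -/
theorem exists_projSum_le {n : ℕ} (hn : 0 < n) {A : Finset (Fin n → ℤ)}
    (hA : IsWeakAntichain (A : Set (Fin n → ℤ))) :
    ∃ B : Finset (Fin n → ℕ), (∀ x ∈ B, x ∈ orthant True (univ : Finset (Fin n))) ∧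
      B.card = A.card ∧ (projSum univ B : ℤ) - B.card ≤ gap A := by
  -- The last condition interpolates: for `S = ∅` it is the weak antichain property, and for `S =
  -- univ` with `x = y` it excludes points with all coordinates positive.
  have key : ∀ S : Finset (Fin n), ∃ B : Finset (Fin n → ℤ), B.card = A.card ∧
      (∀ j, (B.image fun x => update x j 0).card ≤ (A.image fun x => update x j 0).card) ∧
      (∀ x ∈ B, ∀ i ∈ S, 0 ≤ x i) ∧
      ∀ x ∈ B, ∀ y ∈ B, ¬ ((∀ i ∈ S, 0 < x i ∧ x i = y i) ∧ ∀ i ∉ S, x i < y i) := by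
    intro S
    induction S using Finset.induction_on with
    | empty =>
      refine ⟨A, rfl, fun _ => le_rfl, by simp, fun x hx y hy ⟨_, h⟩ => ?_⟩
      have h' : ∀ i, x i < y i := fun i => h i (notMem_empty i)
      refine hA hx hy ?_ h'
      rintro rfl
      exact lt_irrefl _ (h' ⟨0, hn⟩)
    | insert i S hi ih =>
      obtain ⟨B, hcard, hproj, hnonneg, hB⟩ := ih
      obtain ⟨C, K, hCcard, hCproj, hC⟩ := exists_lift B i
      refine ⟨C, hCcard.trans hcard, fun j => (hCproj j).trans (hproj j), ?_, ?_⟩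
      · intro x hx j hj
        by_cases hji : j = i
        · rw [hji]
          exact (hC x hx).1
        · obtain ⟨s, hs⟩ := (hC x hx).2.1
          have := hnonneg _ hs j (mem_of_mem_insert_of_ne hj hji)
          rwa [update_of_ne hji] at this
      · rintro x hx y hy ⟨h1, h2⟩
        obtain ⟨hxi, hxy⟩ := h1 i (mem_insert_self i S)
        obtain ⟨-, s, hs, hsB⟩ := (hC x hx).2.2 hxi
        obtain ⟨hyB, -⟩ := (hC y hy).2.2 (hxy ▸ hxi)
        -- With equal positive heights, both points were translated by `K`. Replacing the preimage
        -- of `x` by a lower point on its line makes coordinate `i` strict and gives a forbidden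
        -- pair in `B`.
        refine hB _ hsB _ hyB ⟨fun j hj => ?_, fun j hj => ?_⟩
        · have hji : j ≠ i := fun h => hi (h ▸ hj)
          rw [update_of_ne hji, update_of_ne hji]
          exact h1 j (mem_insert_of_mem hj)
        · by_cases hji : j = i
          · subst hji
            rwa [update_self, update_self, ← hxy]
          · rw [update_of_ne hji, update_of_ne hji]
            exact h2 j fun h => hj (mem_of_mem_insert_of_ne h hji)
  obtain ⟨C, hcard, hproj, hnonneg, hC⟩ := key univ
  obtain ⟨B, rfl⟩ := exists_image_castPoint fun x hx i => hnonneg x hx i (mem_univ i)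
  rw [card_image_castPoint] at hcard
  refine ⟨B, fun x hx => castPoint_mem_X.1 ?_, hcard, ?_⟩
  · have hx' := mem_image_of_mem castPoint hx
    refine ⟨fun i => hnonneg _ hx' i (mem_univ i), ?_⟩
    by_contra! h
    refine hC _ hx' _ hx' ⟨fun i hi => ⟨?_, rfl⟩, fun i hi => absurd (mem_univ i) hi⟩
    exact lt_of_le_of_ne (hnonneg _ hx' i hi) (h i).symm
  · rw [← gap_image_castPoint]
    unfold gap
    rw [card_image_castPoint, hcard]
    refine sub_le_sub_right (sum_le_sum fun j _ => ?_) _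
    rw [card_image_proj, card_image_proj]
    exact_mod_cast hproj j

/-! ### Agreement of the key with the balanced order -/

theorem mem_diffSet {n : ℕ} {x y : Fin n → ℤ} {i : Fin n} : i ∈ diffSet x y ↔ x i ≠ y i := by
  simp [diffSet]

theorem balancedLT_castPoint {n : ℕ} {x y : Fin n → ℕ} :
    BalancedLT (castPoint x) (castPoint y) ↔ balancedKey x < balancedKey y := by
  have hT : ∀ {i}, i ∈ diffSet (castPoint x) (castPoint y) ↔ x i ≠ y i := by
    simp [mem_diffSet, castPoint]
  rw [balancedKey_lt_iff]
  constructor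
  · rintro ⟨hne, h | ⟨heq, h⟩⟩
    · obtain ⟨k, hk, hmax⟩ := exists_mem_eq_sup' hne (castPoint y)
      refine ⟨k, hT.1 hk, fun i hi => exponent_lt_of_lt i k ?_⟩
      have := (le_sup' (castPoint x) (hT.2 hi)).trans_lt h
      rw [hmax] at this
      exact castPoint_lt.1 this
    · obtain ⟨k₀, hk₀, hmax⟩ := exists_mem_eq_sup' hne (castPoint y)
      obtain ⟨k, hk⟩ := max_of_mem (mem_filter.2 ⟨hk₀, hmax.symm⟩ :
        k₀ ∈ (diffSet (castPoint x) (castPoint y)).filter fun i => castPoint y i =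
          (diffSet (castPoint x) (castPoint y)).sup' hne (castPoint y))
      obtain ⟨hkT, hky⟩ := mem_filter.1 (mem_of_max hk)
      refine ⟨k, hT.1 hkT, fun i hi => ?_⟩
      have hle := le_sup' (castPoint x) (hT.2 hi)
      rcases hle.lt_or_eq with hlt | hxi
      · rw [heq, ← hky] at hlt
        exact exponent_lt_of_lt i k (castPoint_lt.1 hlt)
      · have h1 := (le_max (mem_filter.2 ⟨hT.2 hi, hxi⟩)).trans_lt h
        rw [hk, WithBot.coe_lt_coe] at h1
        rw [heq, ← hky] at hxi
        have hxi' : x i = y k := castPoint_eq.1 hxi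
        rw [hxi']
        exact Nat.add_lt_add_left h1 _
  · rintro ⟨k, hk, h⟩
    have hkT := hT.2 hk
    refine ⟨⟨k, hkT⟩, ?_⟩
    have hx : (diffSet (castPoint x) (castPoint y)).sup' ⟨k, hkT⟩ (castPoint x) ≤ castPoint y k :=
      sup'_le _ _ fun i hi => castPoint_le.2 (le_of_exponent_lt (h i (hT.1 hi)))
    have hy := le_sup' (castPoint y) hkT
    rcases (hx.trans hy).lt_or_eq with hlt | heq
    · exact Or.inl hlt
    · refine Or.inr ⟨heq, lt_of_lt_of_le ?_ (le_max (mem_filter.2 ⟨hkT, ?_⟩))⟩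
      · refine (Finset.sup_lt_iff (WithBot.bot_lt_coe k)).2 fun i hi => ?_
        obtain ⟨hiT, hxi⟩ := mem_filter.1 hi
        have h1 := h i (hT.1 hiT)
        have hxi' : x i = y k := castPoint_eq.1 (hxi.trans (le_antisymm hx (hy.trans heq.ge)))
        rw [hxi'] at h1
        exact WithBot.coe_lt_coe.2 (by simpa using h1)
      · exact le_antisymm hy (heq.ge.trans hx)

theorem isBalancedInitialSegment_image_castPoint {n : ℕ} {J : Finset (Fin n → ℕ)} :
    IsBalancedInitialSegment (J.image castPoint) ↔
      IsInitial (orthant True (univ : Finset (Fin n))) J := by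
  constructor
  · refine fun h => ⟨fun x hx => castPoint_mem_X.1 (h.1 _ (mem_image_of_mem _ hx)),
      fun x hx y hy hyx => ?_⟩
    have := h.2 _ (mem_image_of_mem _ hx) _ (castPoint_mem_X.2 hy) (balancedLT_castPoint.2 hyx)
    rwa [castPoint_injective.mem_finset_image] at this
  · intro h
    constructor
    · intro w hw
      obtain ⟨x, hx, rfl⟩ := mem_image.1 hw
      exact castPoint_mem_X.2 (h.1 x hx)
    · intro w hw y hy hyw
      obtain ⟨x, hx, rfl⟩ := mem_image.1 hw
      obtain ⟨y, rfl⟩ : ∃ y', y = castPoint y' :=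
        ⟨fun i => (y i).toNat, funext fun i => by simp [castPoint, hy.1 i]⟩
      exact mem_image_of_mem _
        (h.2 x hx y (castPoint_mem_X.1 hy) (balancedLT_castPoint.1 hyw))

theorem IsBalancedInitialSegment.exists_eq_image {n : ℕ} {I : Finset (Fin n → ℤ)}
    (hI : IsBalancedInitialSegment I) : ∃ J, I = J.image castPoint ∧
      IsInitial (orthant True (univ : Finset (Fin n))) J := by
  obtain ⟨J, rfl⟩ := exists_image_castPoint fun x hx i => (hI.1 x hx).1 i
  exact ⟨J, rfl, isBalancedInitialSegment_image_castPoint.1 hI⟩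

/-! ### Optimality, existence and the cube faces -/

theorem IsBalancedInitialSegment.minimisesGap {n : ℕ} (hn : 0 < n) {I : Finset (Fin n → ℤ)}
    (hI : IsBalancedInitialSegment I) : MinimisesGap I := by
  refine ⟨fun x hx y hy _ hxy => ?_, fun A hA hcard => ?_⟩
  · obtain ⟨i, hi⟩ := (hI.1 y hy).2
    have h1 : x i < y i := hxy i
    exact absurd (h1.trans_eq hi) (not_lt.2 ((hI.1 x hx).1 i))
  · obtain ⟨J, rfl, hJ⟩ := hI.exists_eq_image
    obtain ⟨B, hB, hBcard, hBgap⟩ := exists_projSum_le hn hA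
    rw [card_image_castPoint] at hcard
    have hJB : J.card = B.card := by omega
    have h : (projSum univ J : ℤ) ≤ projSum univ B := by
      exact_mod_cast hJ.projSum_le univ True J B hB hJB
    rw [gap_image_castPoint, hJB]
    omega

theorem existsUnique_isBalancedInitialSegment {n : ℕ} (hn : 2 ≤ n) (m : ℕ) :
    ∃! I : Finset (Fin n → ℤ), IsBalancedInitialSegment I ∧ I.card = m := by
  have hinj : Injective fun t : ℕ => (Pi.single ⟨0, by omega⟩ t : Fin n → ℕ) :=
    Pi.single_injective (M := fun _ : Fin n => ℕ) ⟨0, by omega⟩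
  -- The multiples of one unit vector give `m` points of the boundary; `n ≥ 2` leaves another
  -- coordinate equal to zero.
  obtain ⟨J, hJ, hcard, -⟩ := exists_isInitial (D := orthant True (univ : Finset (Fin n)))
    (A := (range m).image fun t : ℕ => (Pi.single ⟨0, by omega⟩ t : Fin n → ℕ)) (fun x hx => by
      obtain ⟨t, -, rfl⟩ := mem_image.1 hx
      refine ⟨fun i hi => absurd (mem_univ i) hi, fun _ => ⟨⟨1, hn⟩, mem_univ _, ?_⟩⟩
      exact Pi.single_eq_of_ne (by simp) _)
  rw [card_image_of_injective _ hinj, card_range] at hcard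
  refine ⟨J.image castPoint, ⟨isBalancedInitialSegment_image_castPoint.2 hJ, ?_⟩, ?_⟩
  · rw [card_image_castPoint, hcard]
  · rintro I ⟨hI, hIcard⟩
    obtain ⟨L, rfl, hL⟩ := hI.exists_eq_image
    rw [card_image_castPoint] at hIcard
    rw [hL.eq_of_card_eq hJ (hIcard.trans hcard.symm)]

theorem isBalancedInitialSegment_cubeFaces (n N : ℕ) :
    IsBalancedInitialSegment (cubeFaces n N) := by
  have hmem : ∀ x : Fin n → ℤ, x ∈ cubeFaces n N ↔
      (∀ i, 0 ≤ x i ∧ x i ≤ (N : ℤ) - 1) ∧ ∃ i, x i = 0 := fun x => by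
    simp [cubeFaces, Fintype.mem_piFinset]
  constructor
  · intro x hx
    rw [hmem] at hx
    exact ⟨fun i => (hx.1 i).1, hx.2⟩
  · rintro x hx y hy ⟨hT, h⟩
    rw [hmem] at hx ⊢
    refine ⟨fun i => ⟨hy.1 i, ?_⟩, hy.2⟩
    have hle : (diffSet y x).sup' hT y ≤ (diffSet y x).sup' hT x := by
      rcases h with h | h
      · exact h.le
      · exact h.1.le
    have hsup : (diffSet y x).sup' hT x ≤ (N : ℤ) - 1 := sup'_le _ _ fun j _ => (hx.1 j).2
    by_cases hi : y i = x i
    · rw [hi]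
      exact (hx.1 i).2
    · exact ((le_sup' y (mem_diffSet.2 hi)).trans hle).trans hsup

theorem card_cubeFaces (n : ℕ) {N : ℕ} (hN : 1 ≤ N) :
    ((cubeFaces n N).card : ℤ) = (N : ℤ) ^ n - ((N : ℤ) - 1) ^ n := by
  have h := card_filter_add_card_filter_not
    (s := Fintype.piFinset fun _ : Fin n => Finset.Icc (0 : ℤ) ((N : ℤ) - 1))
    (fun x => ∃ i, x i = 0)
  have h1 : ((Fintype.piFinset fun _ : Fin n => Finset.Icc (0 : ℤ) ((N : ℤ) - 1)).filter
      fun x => ¬ ∃ i, x i = 0) = Fintype.piFinset fun _ : Fin n => Finset.Icc 1 ((N : ℤ) - 1) := by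
    ext x
    simp only [mem_filter, Fintype.mem_piFinset, Finset.mem_Icc, not_exists]
    constructor
    · rintro ⟨h, h'⟩ i
      have := h i
      have := h' i
      omega
    · intro h
      refine ⟨fun i => ?_, fun i => ?_⟩ <;> have := h i <;> omega
  rw [h1, Fintype.card_piFinset_const, Fintype.card_piFinset_const, Int.card_Icc, Int.card_Icc] at h
  have h2 : ((N : ℤ) - 1 + 1 - 0).toNat = N := by omega
  have h3 : ((N : ℤ) - 1 + 1 - 1).toNat = N - 1 := by omega
  rw [h2, h3] at h
  unfold cubeFaces
  rw [eq_sub_iff_add_eq]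
  have h4 : ((N : ℤ) - 1) = ((N - 1 : ℕ) : ℤ) := by omega
  rw [h4] at h ⊢
  exact_mod_cast h

theorem theorem2 (n : ℕ) (hn : 2 ≤ n) :
    (∀ m : ℕ,
      (∃! I : Finset (Fin n → ℤ), IsBalancedInitialSegment I ∧ I.card = m) ∧
      ∀ I : Finset (Fin n → ℤ), IsBalancedInitialSegment I → I.card = m → MinimisesGap I) ∧
    (∀ N : ℕ, 1 ≤ N →
      ((cubeFaces n N).card : ℤ) = (N : ℤ) ^ n - ((N : ℤ) - 1) ^ n ∧
      MinimisesGap (cubeFaces n N)) :=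
  ⟨fun m => ⟨existsUnique_isBalancedInitialSegment hn m,
      fun _ hI _ => hI.minimisesGap (by omega)⟩,
    fun N hN => ⟨card_cubeFaces n hN,
      (isBalancedInitialSegment_cubeFaces n N).minimisesGap (by omega)⟩⟩
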